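/- Let $J=J_{2n}=\begin{bmatrix}0&I_n\\-I_n&0\end{bmatrix}$, let $S\in\mathbb{C}^{2n\times 2n}$ be symplectic, i.e. $S^TJS=J$, let $\lambda_1$ be an eigenvalue of $S$ and let $\mu\in\mathbb{C}\setminus\{0\}$. Let $x_1,x_2\in\mathbb{C}^{2n}$ be eigenvectors of $S$ for $\lambda_1$ and $\lambda_1^{-1}$, respectively, normalized such that $X^TJX=J_2$ for $X=[\,x_1\; x_2\,]$, let $R=[r_{ij}]\in\mathbb{C}^{2\times 2}$ satisfy $$(\mu+\mu^{-1})-(\lambda_1+\lambda_1^{-1})=\lambda_1r_{12}-\lambda_1^{-1}r_{21},\qquad 0=r_{12}-r_{21}+r_{11}r_{22}-r_{12}r_{21},$$ and set $\hat S=S+XRX^TJ^TS$. Let $\lambda$ be an eigenvalue of $\hat S$ with $\lambda\notin\{\lambda_1,\lambda_1^{-1},\mu,\mu^{-1}\}$. Then $\lambda$ is an eigenvalue of $S$, and $S$ and $\hat S$ have the same Jordan chains for $\lambda$: for every $p\ge 1$, vectors $y_1,\dots,y_p\in\mathbb{C}^{2n}$ form a Jordan chain of $S$ for $\lambda$ (that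 is, $y_1\ne 0$, $(S-\lambda I)y_1=0$ and $(S-\lambda I)y_{k+1}=y_k$ for $1\le k<p$) if and only if they form a Jordan chain of $\hat S$ for $\lambda$. Moreover, $\lambda$ has the same Segre characteristic (the sequence of the sizes of the Jordan blocks with eigenvalue $\lambda$, in non-increasing order) for $S$ and for $\hat S$. -/

import Mathlib

open scoped Matrix

namespace SymplecticModification

/-- The `2n × 2n` matrix `J = [[0, I], [-I, 0]]`, with rows and columns indexed by the two
blocks. -/
def Jmat (n : ℕ) : Matrix (Fin n ⊕ Fin n) (Fin n ⊕ Fin n) ℂ :=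
  Matrix.fromBlocks 0 1 (-1) 0

/-- The matrix `J` for `n = 1`, with rows and columns indexed by `Fin 2`. -/
def J₂ : Matrix (Fin 2) (Fin 2) ℂ :=
  !![0, 1; -1, 0]

/-- A complex `2n × 2n` matrix `S` is symplectic if `Sᵀ J S = J` (plain transpose). -/
def IsSymplectic {n : ℕ} (S : Matrix (Fin n ⊕ Fin n) (Fin n ⊕ Fin n) ℂ) : Prop :=
  Sᵀ * Jmat n * S = Jmat n

/-- The matrix `X = [x₁ x₂]` with the columns `x₁` and `x₂`. -/
def twoCols {ι : Type*} (x₁ x₂ : ι → ℂ) : Matrix ι (Fin 2) ℂ :=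
  Matrix.of fun i => ![x₁ i, x₂ i]

/-- `Shat` arises from `S` by the symplectic modification that replaces one pair of eigenvalues
`lam₁, lam₁⁻¹` by `μ, μ⁻¹`: there are eigenvectors `x₁, x₂` of `S` for `lam₁, lam₁⁻¹` with
`Xᵀ J X = J₂` for `X = [x₁ x₂]`, and a `2 × 2` matrix `R` satisfying the two scalar conditions
below (`R 0 1` is the entry `r₁₂`, and so on), such that `Shat = S + X R Xᵀ Jᵀ S`. -/
def IsModification {n : ℕ} (S : Matrix (Fin n ⊕ Fin n) (Fin n ⊕ Fin n) ℂ) (lam₁ μ : ℂ)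
    (Shat : Matrix (Fin n ⊕ Fin n) (Fin n ⊕ Fin n) ℂ) : Prop :=
  ∃ (x₁ x₂ : Fin n ⊕ Fin n → ℂ) (R : Matrix (Fin 2) (Fin 2) ℂ),
    x₁ ≠ 0 ∧ S *ᵥ x₁ = lam₁ • x₁ ∧
    x₂ ≠ 0 ∧ S *ᵥ x₂ = lam₁⁻¹ • x₂ ∧
    (twoCols x₁ x₂)ᵀ * Jmat n * twoCols x₁ x₂ = J₂ ∧
    (μ + μ⁻¹) - (lam₁ + lam₁⁻¹) = lam₁ * R 0 1 - lam₁⁻¹ * R 1 0 ∧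
    0 = R 0 1 - R 1 0 + R 0 0 * R 1 1 - R 0 1 * R 1 0 ∧
    Shat = S + twoCols x₁ x₂ * R * (twoCols x₁ x₂)ᵀ * (Jmat n)ᵀ * S

/-- `y 0, …, y (p - 1)` (with `p ≥ 1`) is a Jordan chain of `A` for `lam`: `y 0` is an eigenvector
and `(A - lam I) y (k + 1) = y k`. -/
def IsJordanChain {ι : Type*} [Fintype ι] [DecidableEq ι] (A : Matrix ι ι ℂ) (lam : ℂ)
    {p : ℕ} (y : Fin p → ι → ℂ) : Prop :=
  ∃ hp : 0 < p,
    y ⟨0, hp⟩ ≠ 0 ∧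
    (A - lam • (1 : Matrix ι ι ℂ)) *ᵥ y ⟨0, hp⟩ = 0 ∧
    ∀ (k : ℕ) (hk : k + 1 < p),
      (A - lam • (1 : Matrix ι ι ℂ)) *ᵥ y ⟨k + 1, hk⟩ = y ⟨k, Nat.lt_of_succ_lt hk⟩

/-- The list `s` is the Segre characteristic of `lam` for `A`, the sequence of the sizes of the
Jordan blocks of `A` with eigenvalue `lam` in non-increasing order: there is a basis of the
generalized eigenspace of `A` for `lam` that is composed of Jordan chains of lengths
`s[0] ≥ s[1] ≥ …` (in such a basis `A` acts by a direct sum of Jordan blocks of these sizes). -/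
def IsSegreCharacteristic {ι : Type*} [Fintype ι] [DecidableEq ι] (A : Matrix ι ι ℂ) (lam : ℂ)
    (s : List ℕ) : Prop :=
  s.Pairwise (· ≥ ·) ∧
    ∃ y : (i : Fin s.length) → Fin (s.get i) → ι → ℂ,
      (∀ i, IsJordanChain A lam (y i)) ∧
      LinearIndependent ℂ (fun q : (Σ i : Fin s.length, Fin (s.get i)) => y q.1 q.2) ∧
      Submodule.span ℂ (Set.range fun q : (Σ i : Fin s.length, Fin (s.get i)) => y q.1 q.2) =
        Module.End.maxGenEigenspace (Matrix.toLin' A) lam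

end SymplecticModification

namespace SymplecticModification

open Matrix

/-! With `W = Xᵀ Jᵀ`, the symplectic relation gives `W S = D W` for `D = diag(lam₁⁻¹, lam₁)`, and
then `Shat = S + X R D W` satisfies `W Shat = M W` with `M = (1 - J₂ R) D`. The two conditions on
`R` say that `M` has eigenvalues `μ, μ⁻¹`. As `lam` is an eigenvalue of neither `D` nor `M`, the
generalized eigenvectors of `S` and of `Shat` for `lam` all lie in `ker W`, where the two matrices
agree. -/

section Intertwining

variable {ι : Type*} [Fintype ι] [DecidableEq ι] {A B : Matrix ι ι ℂ} {W : Matrix (Fin 2) ι ℂ}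
  {D : Matrix (Fin 2) (Fin 2) ℂ} {lam : ℂ}

/-- If `W A = D W` and `lam` is not an eigenvalue of `D`, then `W` kills every vector that
`A - lam` maps into the kernel of `W`. -/
theorem mulVec_eq_zero_of_intertwining (hD : W * A = D * W) (hdet : (D - lam • 1).det ≠ 0)
    {v : ι → ℂ} (hv : W *ᵥ ((A - lam • (1 : Matrix ι ι ℂ)) *ᵥ v) = 0) : W *ᵥ v = 0 := by
  apply Matrix.eq_zero_of_mulVec_eq_zero hdet
  rw [← hv, mulVec_mulVec, mulVec_mulVec]
  congr 1
  rw [Matrix.sub_mul, Matrix.mul_sub, hD]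
  simp

/-- Induction along the chain puts every vector of it in `ker W`. Only `A` needs an intertwining
relation, so each direction of the equivalence is one application. -/
theorem IsJordanChain.of_intertwining (hD : W * A = D * W) (hdet : (D - lam • 1).det ≠ 0)
    (hAB : ∀ v, W *ᵥ v = 0 → A *ᵥ v = B *ᵥ v) {p : ℕ} {y : Fin p → ι → ℂ}
    (hy : IsJordanChain A lam y) : IsJordanChain B lam y := by
  obtain ⟨hp, hne, h0, hs⟩ := hy
  have hW : ∀ (k : ℕ) (hk : k < p), W *ᵥ y ⟨k, hk⟩ = 0 := by
    intro k
    induction k with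
    | zero =>
      intro hk
      exact mulVec_eq_zero_of_intertwining hD hdet (by rw [h0, mulVec_zero])
    | succ k ih =>
      intro hk
      exact mulVec_eq_zero_of_intertwining hD hdet (by rw [hs k hk]; exact ih _)
  have hsub : ∀ v, W *ᵥ v = 0 →
      (B - lam • (1 : Matrix ι ι ℂ)) *ᵥ v = (A - lam • (1 : Matrix ι ι ℂ)) *ᵥ v := by
    intro v hv
    rw [sub_mulVec, sub_mulVec, hAB v hv]
  refine ⟨hp, hne, ?_, fun k hk => ?_⟩
  · rw [hsub _ (hW 0 hp), h0]
  · rw [hsub _ (hW _ hk), hs k hk]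

theorem maxGenEigenspace_le_of_intertwining (hD : W * A = D * W)
    (hdet : (D - lam • 1).det ≠ 0) (hAB : ∀ v, W *ᵥ v = 0 → A *ᵥ v = B *ᵥ v) :
    Module.End.maxGenEigenspace (toLin' A) lam ≤ Module.End.maxGenEigenspace (toLin' B) lam := by
  have key : ∀ (k : ℕ) (v : ι → ℂ),
      ((toLin' A - lam • (1 : Module.End ℂ (ι → ℂ))) ^ k) v = 0 →
        W *ᵥ v = 0 ∧ ((toLin' B - lam • (1 : Module.End ℂ (ι → ℂ))) ^ k) v = 0 := by
    intro k
    induction k with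
    | zero =>
      intro v hv
      have hv' : v = 0 := by simpa using hv
      simp [hv']
    | succ k ih =>
      intro v hv
      -- The factor split off acts first, so the induction hypothesis applies to `(A - lam) v`.
      rw [pow_succ, Module.End.mul_apply] at hv
      obtain ⟨h1, h2⟩ := ih _ hv
      have hW : W *ᵥ v = 0 := by
        apply mulVec_eq_zero_of_intertwining hD hdet
        rw [← h1, sub_mulVec, smul_mulVec, one_mulVec]
        simp
      refine ⟨hW, ?_⟩
      rw [pow_succ, Module.End.mul_apply, ← h2]
      congr 1
      simp [hAB v hW]
  intro v hv
  rw [Module.End.mem_maxGenEigenspace] at hv ⊢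
  obtain ⟨k, hk⟩ := hv
  exact ⟨k, (key k v hk).2⟩

end Intertwining

theorem exists_isJordanChain_iff_mem_spectrum {ι : Type*} [Fintype ι] [DecidableEq ι]
    {A : Matrix ι ι ℂ} {lam : ℂ} :
    (∃ y : Fin 1 → ι → ℂ, IsJordanChain A lam y) ↔ lam ∈ spectrum ℂ A := by
  rw [← Matrix.spectrum_toLin', ← Module.End.hasEigenvalue_iff_mem_spectrum]
  constructor
  · rintro ⟨y, hp, hne, h0, -⟩
    refine Module.End.hasEigenvalue_of_hasEigenvector (x := y ⟨0, hp⟩)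
      ⟨Module.End.mem_eigenspace_iff.2 ?_, hne⟩
    rw [sub_mulVec, smul_mulVec, one_mulVec, sub_eq_zero] at h0
    rw [toLin'_apply, h0]
  · intro h
    obtain ⟨v, hv⟩ := h.exists_hasEigenvector
    refine ⟨fun _ => v, Nat.one_pos, hv.2, ?_, fun k hk => by omega⟩
    have := hv.apply_eq_smul
    rw [toLin'_apply] at this
    rw [sub_mulVec, smul_mulVec, one_mulVec, this, sub_self]

theorem IsSegreCharacteristic.congr {ι : Type*} [Fintype ι] [DecidableEq ι]
    {A B : Matrix ι ι ℂ} {lam : ℂ}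
    (hchain : ∀ (p : ℕ) (y : Fin p → ι → ℂ), IsJordanChain A lam y ↔ IsJordanChain B lam y)
    (hgen : Module.End.maxGenEigenspace (toLin' A) lam =
      Module.End.maxGenEigenspace (toLin' B) lam) (s : List ℕ) :
    IsSegreCharacteristic A lam s ↔ IsSegreCharacteristic B lam s := by
  simp only [IsSegreCharacteristic, hchain, hgen]

theorem Jmat_transpose (n : ℕ) : (Jmat n)ᵀ = -Jmat n := by
  simp [Jmat, fromBlocks_transpose, fromBlocks_neg]

/-- An eigenvector `x` of a symplectic `S` for `a ≠ 0` gives the left eigenvector `J x` for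
`a⁻¹`. -/
theorem IsSymplectic.transpose_mulVec_Jmat {n : ℕ}
    {S : Matrix (Fin n ⊕ Fin n) (Fin n ⊕ Fin n) ℂ} (hS : IsSymplectic S) {a : ℂ} (ha : a ≠ 0)
    {x : Fin n ⊕ Fin n → ℂ} (hx : S *ᵥ x = a • x) :
    Sᵀ *ᵥ (Jmat n *ᵥ x) = a⁻¹ • (Jmat n *ᵥ x) := by
  have h : Jmat n *ᵥ x = a • (Sᵀ *ᵥ (Jmat n *ᵥ x)) := by
    conv_lhs => rw [← show Sᵀ * Jmat n * S = Jmat n from hS]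
    rw [← mulVec_mulVec, hx, ← mulVec_mulVec, mulVec_smul, mulVec_smul]
  conv_rhs => rw [h]
  rw [smul_smul, inv_mul_cancel₀ ha, one_smul]

theorem IsSymplectic.isUnit {n : ℕ} {S : Matrix (Fin n ⊕ Fin n) (Fin n ⊕ Fin n) ℂ}
    (hS : IsSymplectic S) : IsUnit S := by
  have h : (-Jmat n * Sᵀ * Jmat n) * S = 1 := by
    have hS' : Sᵀ * Jmat n * S = Jmat n := hS
    rw [Matrix.mul_assoc, Matrix.mul_assoc, ← Matrix.mul_assoc Sᵀ, hS']
    simp [Jmat, fromBlocks_multiply, fromBlocks_neg]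
  exact IsUnit.of_mul_eq_one_right _ h

/-- The rows of `Xᵀ Jᵀ` are the left eigenvectors `(J xᵢ)ᵀ`; passing from right to left eigenvectors
inverts the eigenvalues, hence the order `a⁻¹, a`. -/
theorem IsSymplectic.twoCols_transpose_mul {n : ℕ}
    {S : Matrix (Fin n ⊕ Fin n) (Fin n ⊕ Fin n) ℂ} (hS : IsSymplectic S) {a : ℂ} (ha : a ≠ 0)
    {x₁ x₂ : Fin n ⊕ Fin n → ℂ} (hx₁ : S *ᵥ x₁ = a • x₁) (hx₂ : S *ᵥ x₂ = a⁻¹ • x₂) :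
    ((twoCols x₁ x₂)ᵀ * (Jmat n)ᵀ) * S = !![a⁻¹, 0; 0, a] * ((twoCols x₁ x₂)ᵀ * (Jmat n)ᵀ) := by
  have h₁ := hS.transpose_mulVec_Jmat ha hx₁
  have h₂ := hS.transpose_mulVec_Jmat (inv_ne_zero ha) hx₂
  rw [inv_inv] at h₂
  rw [← transpose_mul, ← transpose_inj, transpose_mul, transpose_transpose, transpose_mul,
    transpose_transpose]
  ext i j
  fin_cases j
  · have := congrFun h₁ i
    simpa [Matrix.mul_apply, mulVec, dotProduct, twoCols, Fin.sum_univ_two, mul_comm] using this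
  · have := congrFun h₂ i
    simpa [Matrix.mul_apply, mulVec, dotProduct, twoCols, Fin.sum_univ_two, mul_comm] using this

end SymplecticModification

open SymplecticModification Matrix in
theorem lemma4p2 (n : ℕ) (S Shat : Matrix (Fin n ⊕ Fin n) (Fin n ⊕ Fin n) ℂ) (lam₁ μ : ℂ)
    (hS : SymplecticModification.IsSymplectic S) (hlam₁ : lam₁ ∈ spectrum ℂ S) (hμ : μ ≠ 0)
    (hShat : SymplecticModification.IsModification S lam₁ μ Shat)
    (lam : ℂ) (hlam : lam ∈ spectrum ℂ Shat)
    (h₁ : lam ≠ lam₁) (h₂ : lam ≠ lam₁⁻¹) (h₃ : lam ≠ μ) (h₄ : lam ≠ μ⁻¹) :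
    lam ∈ spectrum ℂ S ∧
    (∀ (p : ℕ) (y : Fin p → Fin n ⊕ Fin n → ℂ),
      SymplecticModification.IsJordanChain S lam y ↔
        SymplecticModification.IsJordanChain Shat lam y) ∧
    (∀ s : List ℕ,
      SymplecticModification.IsSegreCharacteristic S lam s ↔
        SymplecticModification.IsSegreCharacteristic Shat lam s) := by
  obtain ⟨x₁, x₂, R, -, hx₁, -, hx₂, hX, htr, hdt, hSh⟩ := hShat
  have ha : lam₁ ≠ 0 := by
    rintro rfl
    exact (spectrum.zero_mem_iff ℂ).1 hlam₁ hS.isUnit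
  set X := twoCols x₁ x₂
  set W := Xᵀ * (Jmat n)ᵀ with hW
  set D : Matrix (Fin 2) (Fin 2) ℂ := !![lam₁⁻¹, 0; 0, lam₁] with hD
  have hWS : W * S = D * W := hS.twoCols_transpose_mul ha hx₁ hx₂
  have hWX : W * X = -J₂ := by
    rw [hW, Jmat_transpose, Matrix.mul_neg, Matrix.neg_mul, hX]
  have hSh' : Shat = S + X * R * D * W := by
    rw [hSh, Matrix.mul_assoc (X * R) D, ← hWS, hW]
    simp only [Matrix.mul_assoc]
  have hWSh : W * Shat = ((1 - J₂ * R) * D) * W := by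
    rw [hSh', Matrix.mul_add, hWS, Matrix.sub_mul, Matrix.sub_mul, Matrix.one_mul]
    simp only [← Matrix.mul_assoc, hWX]
    simp [sub_eq_add_neg]
  have hdetD : (D - lam • 1).det ≠ 0 := by
    have : (D - lam • 1).det = (lam₁⁻¹ - lam) * (lam₁ - lam) := by
      simp [hD, det_fin_two]
    rw [this]
    exact mul_ne_zero (sub_ne_zero.2 h₂.symm) (sub_ne_zero.2 h₁.symm)
  have hdetM : ((1 - J₂ * R) * D - lam • 1).det ≠ 0 := by
    -- `htr` says that `(1 - J₂ R) D` has trace `μ + μ⁻¹`, and `hdt` that its determinant is `1`.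
    have : ((1 - J₂ * R) * D - lam • 1).det = (μ - lam) * (μ⁻¹ - lam) := by
      simp [hD, J₂, det_fin_two, Matrix.mul_apply, Fin.sum_univ_two, vecMul, dotProduct]
      have e₁ := mul_inv_cancel₀ ha
      have e₂ := mul_inv_cancel₀ hμ
      linear_combination (lam) * htr - hdt - e₂ +
        (1 + R 0 1 - R 1 0 + R 0 0 * R 1 1 - R 0 1 * R 1 0) * e₁
    rw [this]
    exact mul_ne_zero (sub_ne_zero.2 h₃.symm) (sub_ne_zero.2 h₄.symm)
  have hagree : ∀ v, W *ᵥ v = 0 → S *ᵥ v = Shat *ᵥ v := by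
    intro v hv
    rw [hSh', add_mulVec, ← mulVec_mulVec _ _ W, hv, mulVec_zero, add_zero]
  have hagree' : ∀ v, W *ᵥ v = 0 → Shat *ᵥ v = S *ᵥ v := fun v hv => (hagree v hv).symm
  have hchain : ∀ (p : ℕ) (y : Fin p → Fin n ⊕ Fin n → ℂ),
      IsJordanChain S lam y ↔ IsJordanChain Shat lam y := fun p y =>
    ⟨fun h => h.of_intertwining hWS hdetD hagree, fun h => h.of_intertwining hWSh hdetM hagree'⟩
  refine ⟨?_, hchain, IsSegreCharacteristic.congr hchain (le_antisymm
    (maxGenEigenspace_le_of_intertwining hWS hdetD hagree)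
    (maxGenEigenspace_le_of_intertwining hWSh hdetM hagree'))⟩
  -- Eigenvectors are chains of length one, so the eigenvalue claim is the case `p = 1`.
  obtain ⟨y, hy⟩ := exists_isJordanChain_iff_mem_spectrum.2 hlam
  exact exists_isJordanChain_iff_mem_spectrum.1 ⟨y, (hchain 1 y).2 hy⟩
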